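/- All graphs are finite and simple. Two edges are adjacent if they are distinct and share an endpoint. For a graph $G$, an edge dominating set is a set $F$ of edges such that every edge not in $F$ is adjacent to an edge in $F$; a total edge dominating set is a set $F$ of edges such that every edge of $G$ is adjacent to an edge in $F$. The minimum cardinalities of such sets are denoted by $\gamma'(G)$ and $\gamma'_t(G)$, respectively. A leaf is a vertex of degree one. A star is a tree with a vertex incident with all of its edges (so the trees on one and on two vertices count as stars). Let $\mathcal{T}$ be the smallest family of trees with vertices labelled $C$ or $L$, closed under isomorphism of labelled trees, which contains the path $P_4$ on four vertices with its two leaves labelled $L$ and its two inner vertices labelled $C$, and which is closed under the following two operations, applied to $T \in \mathcal{T}$. Operation $\mathcal{O}_1$. Let $v$ be a vertex of $T$ labelled $L$ such that (1) each vertex labelled $C$ at distance $2$ from $v$ is adjacent to a leaf; and (2) for each edge $uw$ with both endpoints labelled $C$ and with $u$ adjacent to $v$, either $u$ is adjacent to a leaf other than $v$, or all neighbours of $w$ other than $u$ are leaves. Take the disjoint union of $T$ and a copy of the labelled $P_4$ above and identify $v$ with a leaf of that $P_4$; the identified vertex is labelled $L$ and all other labels are kept. Operation $\mathcal{O}_2$.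 Let $v$ be a vertex of $T$ labelled $C$. Add a new vertex adjacent only to $v$ and label it $L$; all other labels are kept. An unlabelled tree is said to belong to $\mathcal{T}$ if its vertices can be labelled so that the resulting labelled tree is in $\mathcal{T}$. Theorem. Let $T$ be a tree that is not a star. Then $\gamma'_t(T) = 2\gamma'(T)$ if and only if $T$ belongs to $\mathcal{T}$. -/

import Mathlib

universe u

namespace EdgeDom

/-- `F` is an edge dominating set of `G`: every edge of `G` not in `F` is adjacent to an edge in
`F`. Two edges are adjacent when they are distinct and share an endpoint, i.e. when they are
adjacent in the line graph. -/
def IsEdgeDominating {V : Type u} (G : SimpleGraph V) (F : Finset G.edgeSet) : Prop :=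
  ∀ e : G.edgeSet, e ∉ F → ∃ f ∈ F, G.lineGraph.Adj e f

/-- `F` is a total edge dominating set of `G`: every edge of `G` (in `F` or not) is adjacent to an
edge in `F`. -/
def IsTotalEdgeDominating {V : Type u} (G : SimpleGraph V) (F : Finset G.edgeSet) : Prop :=
  ∀ e : G.edgeSet, ∃ f ∈ F, G.lineGraph.Adj e f

/-- The edge domination number: the minimum cardinality of an edge dominating set. -/
noncomputable def edgeDominationNumber {V : Type u} (G : SimpleGraph V) : ℕ :=
  sInf {n : ℕ | ∃ F : Finset G.edgeSet, IsEdgeDominating G F ∧ F.card = n}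

/-- The total edge domination number: the minimum cardinality of a total edge dominating set.
(Such a set exists in every finite connected graph other than `K₂`.) -/
noncomputable def totalEdgeDominationNumber {V : Type u} (G : SimpleGraph V) : ℕ :=
  sInf {n : ℕ | ∃ F : Finset G.edgeSet, IsTotalEdgeDominating G F ∧ F.card = n}

/-- A leaf is a vertex of degree one. -/
def IsLeaf {V : Type u} (G : SimpleGraph V) (x : V) : Prop :=
  ∃! y : V, G.Adj x y

/-- The two vertex labels. -/
inductive VLabel : Type
  | C : VLabel
  | L : VLabel

/-- The side conditions on the vertex `v` of a labelled tree `(G, l)` for attaching a `P₄`: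
`v` has label `L`; every vertex with label `C` at distance two from `v` is adjacent to a leaf; and
for every edge `uw` with both endpoints labelled `C` and with `u` adjacent to `v`, either `u` is
adjacent to a leaf other than `v`, or all neighbours of `w` other than `u` are leaves. -/
def CanAttach {V : Type u} (G : SimpleGraph V) (l : V → VLabel) (v : V) : Prop :=
  l v = VLabel.L ∧
  (∀ w : V, l w = VLabel.C → G.dist v w = 2 → ∃ x : V, G.Adj w x ∧ IsLeaf G x) ∧
  (∀ u w : V, G.Adj v u → G.Adj u w → l u = VLabel.C → l w = VLabel.C →
    (∃ x : V, x ≠ v ∧ G.Adj u x ∧ IsLeaf G x) ∨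
    (∀ x : V, G.Adj w x → x ≠ u → IsLeaf G x))

/-- The graph obtained from `G` and a path on four vertices by identifying `v` with an end of the
path. The three other vertices of the path are, in order, `inr 0`, `inr 1`, `inr 2`. -/
def attachPath {V : Type u} (G : SimpleGraph V) (v : V) : SimpleGraph (V ⊕ Fin 3) where
  Adj
    | Sum.inl a, Sum.inl b => G.Adj a b
    | Sum.inl a, Sum.inr j => a = v ∧ j = 0
    | Sum.inr i, Sum.inl b => b = v ∧ i = 0
    | Sum.inr i, Sum.inr j => (SimpleGraph.pathGraph 3).Adj i j
  symm := ⟨by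
    rintro (a | i) (b | j) h
    · exact SimpleGraph.Adj.symm h
    · exact h
    · exact h
    · exact SimpleGraph.Adj.symm h⟩
  loopless := ⟨by
    rintro (a | i) h
    · exact G.irrefl h
    · exact (SimpleGraph.pathGraph 3).irrefl h⟩

/-- The graph obtained from `G` by adding one new vertex `none`, adjacent exactly to `v`. -/
def attachLeaf {V : Type u} (G : SimpleGraph V) (v : V) : SimpleGraph (Option V) where
  Adj
    | some a, some b => G.Adj a b
    | some a, none => a = v
    | none, some b => b = v
    | none, none => False
  symm := ⟨by
    rintro (_ | a) (_ | b) h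
    · exact h
    · exact h
    · exact h
    · exact SimpleGraph.Adj.symm h⟩
  loopless := ⟨by
    rintro (_ | a) h
    · exact h
    · exact G.irrefl h⟩

/-- The family of labelled trees generated from the labelled `P₄` (ends labelled `L`, inner
vertices labelled `C`) by the two operations, up to isomorphism of labelled graphs. -/
inductive LabelledFamily : ∀ {V : Type u}, SimpleGraph V → (V → VLabel) → Prop
  | base {V : Type u} (G : SimpleGraph V) (l : V → VLabel) (e : SimpleGraph.pathGraph 4 ≃g G)
      (hl : ∀ i : Fin 4, l (e i) = ![VLabel.L, VLabel.C, VLabel.C, VLabel.L] i) :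
      LabelledFamily G l
  | op1 {V : Type u} (G : SimpleGraph V) (l : V → VLabel) (v : V)
      (h : LabelledFamily G l) (hv : CanAttach G l v) :
      LabelledFamily (attachPath G v) (Sum.elim l ![VLabel.C, VLabel.C, VLabel.L])
  | op2 {V : Type u} (G : SimpleGraph V) (l : V → VLabel) (v : V)
      (h : LabelledFamily G l) (hv : l v = VLabel.C) :
      LabelledFamily (attachLeaf G v) (fun x : Option V => x.elim VLabel.L l)
  | iso {V W : Type u} (G : SimpleGraph V) (H : SimpleGraph W) (l : V → VLabel) (m : W → VLabel)
      (h : LabelledFamily G l) (e : G ≃g H) (hl : ∀ x : V, m (e x) = l x) :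
      LabelledFamily H m

/-- A tree belongs to the family when some labelling of its vertices makes it a member of the
family of labelled trees. -/
def InFamily {V : Type u} (T : SimpleGraph V) : Prop :=
  ∃ l : V → VLabel, LabelledFamily T l

end EdgeDom

/-!
The proof goes through a static description of the labelled trees generated by the two operations,
`EdgeDom.IsDoubleStarLabelling`. The edges with both ends labelled `C` form an induced matching that
covers the vertices labelled `C`, and the other edges join a `C` to an `L`. So the tree is a union
of edge-disjoint double stars, one around each edge `uw` of this matching, glued at vertices
labelled `L`; moreover, if `u` has a neighbour other than `w` that is not a leaf, then `w` has a
leaf. This last condition is what the side conditions of the first operation preserve, and both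
operations preserve the rest (`LabelledFamily.isDoubleStarLabelling`).

Such a labelling forces `γ'ₜ = 2γ'`. In a connected graph that is not a star, `γ'ₜ ≤ 2γ'`: add to
each member of an edge dominating set an adjacent edge. Conversely, the matching is an edge
dominating set, and a total edge dominating set has two edges in each double star, because of the
leaves around it (`two_le_card_filter`).

If `γ'ₜ = 2γ'`, then no choice of adjacent edges for the members of a minimum edge dominating set
`F` may save an edge, so that `F` is an induced matching and no edge is adjacent to two of its
members. Label its ends `C`. An end of `ab ∈ F` without a neighbour labelled `L` would be a leaf
`a`, and exchanging `ab` for another edge at `b` would violate this property of minimum sets. If the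
condition on leaves failed at `uw`, then dropping `uw` and directing the extra edges towards `u` and
`w` would give a total edge dominating set that is too small; acyclicity ensures that one extra edge
per member of `F` suffices (`exists_isLeaf_of_card_eq`).

Finally, a tree with such a labelling is generated by the operations
(`IsDoubleStarLabelling.labelledFamily`): a double star of maximal depth has only leaves around,
except for one vertex; its spare leaves and then the remaining path on three vertices are deleted.
-/

namespace EdgeDom
open SimpleGraph

/-! ### Double star labellings -/

/-- A labelling exhibiting `G` as double stars glued along vertices labelled `L`: every `C` has
exactly one neighbour labelled `C` and at least one labelled `L`, the vertices labelled `L` are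
independent, and the ends of an edge with both ends labelled `C` have no common neighbour. The
field `leaf_of_not_leaf` says, for such an edge `uw`, that `w` has a leaf as soon as `u` has a
neighbour other than `w` that is not a leaf. -/
structure IsDoubleStarLabelling {V : Type u} (G : SimpleGraph V) (l : V → VLabel) : Prop where
  exists_partner : ∀ c, l c = .C → ∃ d, G.Adj c d ∧ l d = .C
  partner_unique : ∀ c d d', l c = .C → G.Adj c d → l d = .C → G.Adj c d' → l d' = .C → d = d'
  exists_L : ∀ c, l c = .C → ∃ x, G.Adj c x ∧ l x = .L
  indep : ∀ x y, G.Adj x y → l x = .L → l y = .C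
  triangle : ∀ u w v, l u = .C → l w = .C → G.Adj u w → G.Adj u v → ¬ G.Adj w v
  leaf_of_not_leaf : ∀ u w v, l u = .C → l w = .C → G.Adj u w → G.Adj u v → v ≠ w →
    ¬ IsLeaf G v → ∃ x, G.Adj w x ∧ IsLeaf G x

lemma VLabel.eq_L_of_ne {a : VLabel} (h : a ≠ .C) : a = .L := by cases a <;> simp_all
lemma VLabel.eq_C_of_ne {a : VLabel} (h : a ≠ .L) : a = .C := by cases a <;> simp_all

lemma IsLeaf.eq {V : Type u} {G : SimpleGraph V} {x y z : V} (h : IsLeaf G x) (hy : G.Adj x y)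
    (hz : G.Adj x z) : y = z := h.unique hy hz

lemma isLeaf_iff_forall {V : Type u} {G : SimpleGraph V} {x y : V} (h : G.Adj x y) :
    IsLeaf G x ↔ ∀ z, G.Adj x z → z = y :=
  ⟨fun hx _ hz => hx.eq hz h, fun hx => ⟨y, h, hx⟩⟩

lemma exists_adj_ne_of_not_isLeaf {V : Type u} {G : SimpleGraph V} {x y : V} (h : G.Adj x y)
    (hx : ¬ IsLeaf G x) : ∃ z, G.Adj x z ∧ z ≠ y := by
  rw [isLeaf_iff_forall h] at hx
  push Not at hx
  exact hx

lemma isLeaf_iso {V W : Type*} {G : SimpleGraph V} {H : SimpleGraph W} (e : G ≃g H) (x : V) :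
    IsLeaf H (e x) ↔ IsLeaf G x := by
  unfold IsLeaf ExistsUnique
  constructor
  · rintro ⟨y, hy, h⟩
    obtain ⟨y, rfl⟩ := e.surjective y
    exact ⟨y, e.map_adj_iff.1 hy, fun z hz => e.injective (h _ (e.map_adj_iff.2 hz))⟩
  · rintro ⟨y, hy, h⟩
    refine ⟨e y, e.map_adj_iff.2 hy, fun z hz => ?_⟩
    obtain ⟨z, rfl⟩ := e.surjective z
    rw [h z (e.map_adj_iff.1 hz)]

namespace IsDoubleStarLabelling
variable {V : Type u} {G : SimpleGraph V} {l : V → VLabel}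

lemma not_isLeaf (h : IsDoubleStarLabelling G l) {c : V} (hc : l c = .C) : ¬ IsLeaf G c := by
  intro hl
  obtain ⟨d, hd, hdC⟩ := h.exists_partner c hc
  obtain ⟨x, hx, hxL⟩ := h.exists_L c hc
  rw [hl.eq hd hx, hxL] at hdC
  cases hdC

lemma eq_L_of_isLeaf (h : IsDoubleStarLabelling G l) {c : V} (hc : IsLeaf G c) : l c = .L :=
  VLabel.eq_L_of_ne fun hC => h.not_isLeaf hC hc

/-- A neighbour of a vertex labelled `C` other than its partner is labelled `L`. -/
lemma eq_L (h : IsDoubleStarLabelling G l) {u w x : V} (hu : l u = .C) (hw : l w = .C)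
    (huw : G.Adj u w) (hx : G.Adj u x) (hxw : x ≠ w) : l x = .L :=
  VLabel.eq_L_of_ne fun hC => hxw (h.partner_unique u x w hu hx hC huw hw)

lemma iso {W : Type*} {H : SimpleGraph W} {m : W → VLabel} (h : IsDoubleStarLabelling G l)
    (e : G ≃g H) (hl : ∀ x, m (e x) = l x) : IsDoubleStarLabelling H m where
  exists_partner c hc := by
    obtain ⟨c, rfl⟩ := e.surjective c
    obtain ⟨d, hd, hd'⟩ := h.exists_partner c (hl c ▸ hc)
    exact ⟨e d, e.map_adj_iff.2 hd, (hl d).trans hd'⟩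
  partner_unique c d d' := by
    obtain ⟨c, rfl⟩ := e.surjective c
    obtain ⟨d, rfl⟩ := e.surjective d
    obtain ⟨d', rfl⟩ := e.surjective d'
    simpa only [hl, e.map_adj_iff, e.injective.eq_iff] using h.partner_unique c d d'
  exists_L c hc := by
    obtain ⟨c, rfl⟩ := e.surjective c
    obtain ⟨d, hd, hd'⟩ := h.exists_L c (hl c ▸ hc)
    exact ⟨e d, e.map_adj_iff.2 hd, (hl d).trans hd'⟩
  indep c d := by
    obtain ⟨c, rfl⟩ := e.surjective c
    obtain ⟨d, rfl⟩ := e.surjective d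
    simpa only [hl, e.map_adj_iff] using h.indep c d
  triangle u w v := by
    obtain ⟨u, rfl⟩ := e.surjective u
    obtain ⟨w, rfl⟩ := e.surjective w
    obtain ⟨v, rfl⟩ := e.surjective v
    simpa only [hl, e.map_adj_iff] using h.triangle u w v
  leaf_of_not_leaf u w v hu hw huw huv hvw hv := by
    obtain ⟨u, rfl⟩ := e.surjective u
    obtain ⟨w, rfl⟩ := e.surjective w
    obtain ⟨v, rfl⟩ := e.surjective v
    obtain ⟨x, hx, hx'⟩ := h.leaf_of_not_leaf u w v (hl u ▸ hu) (hl w ▸ hw) (e.map_adj_iff.1 huw)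
      (e.map_adj_iff.1 huv) (fun h => hvw (h ▸ rfl)) (fun h => hv ((isLeaf_iso e v).2 h))
    exact ⟨e x, e.map_adj_iff.2 hx, (isLeaf_iso e x).2 hx'⟩

/-! ### The generated labelled trees -/

lemma pathGraph_four :
    IsDoubleStarLabelling (pathGraph 4) ![VLabel.L, VLabel.C, VLabel.C, VLabel.L] := by
  have h0 : IsLeaf (pathGraph 4) 0 := by
    unfold IsLeaf ExistsUnique; simp only [pathGraph_adj]; decide
  have h3 : IsLeaf (pathGraph 4) 3 := by
    unfold IsLeaf ExistsUnique; simp only [pathGraph_adj]; decide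
  refine ⟨?_, ?_, ?_, ?_, ?_, ?_⟩
  · intro c hc
    fin_cases c <;> simp at hc
    · exact ⟨2, by simp [pathGraph_adj], rfl⟩
    · exact ⟨1, by simp [pathGraph_adj], rfl⟩
  · intro c d d' hc h1 hd h2 hd'
    rw [pathGraph_adj] at h1 h2
    fin_cases d <;> simp at hd <;> fin_cases d' <;> simp at hd' <;> simp at h1 h2 ⊢ <;> omega
  · intro c hc
    fin_cases c <;> simp at hc
    · exact ⟨0, by simp [pathGraph_adj], rfl⟩
    · exact ⟨3, by simp [pathGraph_adj], rfl⟩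
  · intro x y h hx
    rw [pathGraph_adj] at h
    fin_cases x <;> simp at hx <;> fin_cases y <;> simp at h ⊢
  · intro u w v _ _
    simp only [pathGraph_adj]
    omega
  · intro u w v hu hw huw huv
    fin_cases w <;> simp at hw
    · exact fun _ _ => ⟨0, by simp [pathGraph_adj], h0⟩
    · exact fun _ _ => ⟨3, by simp [pathGraph_adj], h3⟩

section attach
variable {v : V}

@[simp] lemma attachLeaf_some_some {a b : V} : (attachLeaf G v).Adj (some a) (some b) ↔ G.Adj a b :=
  Iff.rfl
@[simp] lemma attachLeaf_some_none {a : V} : (attachLeaf G v).Adj (some a) none ↔ a = v := Iff.rfl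
@[simp] lemma attachLeaf_none_some {a : V} : (attachLeaf G v).Adj none (some a) ↔ a = v := Iff.rfl
@[simp] lemma attachPath_inl_inl {a b : V} : (attachPath G v).Adj (.inl a) (.inl b) ↔ G.Adj a b :=
  Iff.rfl
@[simp] lemma attachPath_inr_inl {a : V} {i : Fin 3} :
    (attachPath G v).Adj (.inr i) (.inl a) ↔ a = v ∧ i = 0 := Iff.rfl
@[simp] lemma attachPath_inr_inr {i j : Fin 3} :
    (attachPath G v).Adj (.inr i) (.inr j) ↔ (pathGraph 3).Adj i j := Iff.rfl

lemma isLeaf_attachLeaf_none : IsLeaf (attachLeaf G v) none :=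
  ⟨some v, rfl, by rintro (_ | b) hb <;> simp_all⟩

lemma isLeaf_attachLeaf_some {x : V} (hx : x ≠ v) :
    IsLeaf (attachLeaf G v) (some x) ↔ IsLeaf G x := by
  constructor
  · rintro ⟨_ | y, hy, h⟩
    · exact absurd hy hx
    · exact ⟨y, hy, fun z hz => by simpa using h (some z) hz⟩
  · rintro ⟨y, hy, h⟩
    refine ⟨some y, hy, ?_⟩
    rintro (_ | z) hz
    · exact absurd hz hx
    · rw [h z hz]

lemma attachLeaf (h : IsDoubleStarLabelling G l) (hv : l v = .C) :
    IsDoubleStarLabelling (attachLeaf G v) (fun x : Option V => x.elim VLabel.L l) where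
  exists_partner := by
    rintro (_ | c) hc
    · cases hc
    · obtain ⟨d, hd, hd'⟩ := h.exists_partner c hc
      exact ⟨some d, hd, hd'⟩
  partner_unique := by
    rintro (_ | c) (_ | d) (_ | d') hc h1 hd h2 hd' <;> simp_all
    exact h.partner_unique c d d' hc h1 hd h2 hd'
  exists_L := by
    rintro (_ | c) hc
    · cases hc
    · obtain ⟨d, hd, hd'⟩ := h.exists_L c hc
      exact ⟨some d, hd, hd'⟩
  indep := by
    rintro (_ | c) (_ | d) hcd hc <;> simp_all
    exact h.indep c d hcd hc
  triangle := by
    rintro (_ | u) (_ | w) (_ | x) hu hw huw hux hwx <;> simp_all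
    exact h.triangle u w x hu hw huw hux hwx
  leaf_of_not_leaf := by
    rintro (_ | u) (_ | w) x hu hw huw hux hxw hx
    · cases hu
    · cases hu
    · cases hw
    · rcases x with _ | x
      · exact absurd isLeaf_attachLeaf_none hx
      · have hxL : l x = .L := h.eq_L hu hw huw hux (by simpa using hxw)
        have hxv : x ≠ v := by rintro rfl; simp [hv] at hxL
        obtain ⟨y, hy, hy'⟩ := h.leaf_of_not_leaf u w x hu hw huw hux (by simpa using hxw)
          (by rwa [isLeaf_attachLeaf_some hxv] at hx)
        refine ⟨some y, hy, (isLeaf_attachLeaf_some ?_).2 hy'⟩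
        rintro rfl
        exact h.not_isLeaf hv hy'

lemma isLeaf_attachPath_inl {x : V} (hx : x ≠ v) :
    IsLeaf (attachPath G v) (.inl x) ↔ IsLeaf G x := by
  constructor
  · rintro ⟨y | y, hy, h⟩
    · exact ⟨y, hy, fun z hz => by simpa using h (.inl z) hz⟩
    · exact absurd hy.1 hx
  · rintro ⟨y, hy, h⟩
    refine ⟨.inl y, hy, ?_⟩
    rintro (z | z) hz
    · rw [h z hz]
    · exact absurd hz.1 hx

lemma isLeaf_attachPath_inr_two : IsLeaf (attachPath G v) (.inr 2) := by
  refine ⟨.inr 1, by simp [pathGraph_adj], ?_⟩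
  rintro (z | z) hz
  · simp at hz
  · simp only [attachPath_inr_inr, pathGraph_adj] at hz
    fin_cases z <;> simp at hz ⊢

/-- The two side conditions on the attachment vertex are exactly what keeps the leaf condition
alive once that vertex has acquired another neighbour. -/
lemma attachPath (h : IsDoubleStarLabelling G l) (hv : CanAttach G l v) :
    IsDoubleStarLabelling (attachPath G v) (Sum.elim l ![VLabel.C, VLabel.C, VLabel.L]) where
  exists_partner := by
    rintro (c | c) hc
    · obtain ⟨d, hd, hd'⟩ := h.exists_partner c hc
      exact ⟨.inl d, hd, hd'⟩
    · fin_cases c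
      · exact ⟨.inr 1, by simp [pathGraph_adj], rfl⟩
      · exact ⟨.inr 0, by simp [pathGraph_adj], rfl⟩
      · simp at hc
  partner_unique := by
    have hv := hv.1
    rintro (c | c) (d | d) (d' | d') hc h1 hd h2 hd'
    · rw [h.partner_unique c d d' hc h1 hd h2 hd']
    · obtain ⟨rfl, -⟩ := h2; simp [hv] at hc
    · obtain ⟨rfl, -⟩ := h1; simp [hv] at hc
    · obtain ⟨rfl, -⟩ := h1; simp [hv] at hc
    · obtain ⟨rfl, -⟩ := h1; simp [hv] at hd
    · obtain ⟨rfl, -⟩ := h1; simp [hv] at hd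
    · obtain ⟨rfl, -⟩ := h2; simp [hv] at hd'
    · simp only [attachPath_inr_inr, pathGraph_adj] at h1 h2
      fin_cases d <;> simp at hd <;> fin_cases d' <;> simp at hd' <;> simp at h1 h2 ⊢ <;> omega
  exists_L := by
    rintro (c | c) hc
    · obtain ⟨d, hd, hd'⟩ := h.exists_L c hc
      exact ⟨.inl d, hd, hd'⟩
    · fin_cases c
      · exact ⟨.inl v, by simp, hv.1⟩
      · exact ⟨.inr 2, by simp [pathGraph_adj], rfl⟩
      · simp at hc
  indep := by
    rintro (c | c) (d | d) hcd hc
    · exact h.indep c d hcd hc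
    · obtain ⟨rfl, rfl⟩ := hcd; rfl
    · obtain ⟨rfl, rfl⟩ := hcd; simp at hc
    · simp only [attachPath_inr_inr, pathGraph_adj] at hcd
      fin_cases c <;> simp at hc; fin_cases d <;> simp at hcd ⊢
  triangle := by
    have hv := hv.1
    rintro (u | u) (w | w) (x | x) hu hw huw hux hwx
    · exact h.triangle u w x hu hw huw hux hwx
    · obtain ⟨rfl, -⟩ := hux; simp [hv] at hu
    · obtain ⟨rfl, -⟩ := huw; simp [hv] at hu
    · obtain ⟨rfl, -⟩ := huw; simp [hv] at hu
    · obtain ⟨rfl, -⟩ := huw; simp [hv] at hw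
    · obtain ⟨rfl, -⟩ := huw; simp [hv] at hw
    · simp only [attachPath_inr_inr, attachPath_inr_inl, pathGraph_adj] at huw hux hwx
      omega
    · simp only [attachPath_inr_inr, pathGraph_adj] at huw hux hwx
      omega
  leaf_of_not_leaf := by
    obtain ⟨hvL, h1, h2⟩ := hv
    rintro (u | u) (w | w) x hu hw huw hux hxw hx
    · rcases x with x | x
      · replace hux : G.Adj u x := hux
        replace huw : G.Adj u w := huw
        replace hxw : x ≠ w := by simpa using hxw
        obtain rfl | hxv := eq_or_ne x v
        · have hd : G.dist x w = 2 := by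
            have hle : G.dist x w ≤ 2 := G.dist_le (.cons hux.symm (.cons huw .nil))
            have h0 : G.dist x w ≠ 0 := by
              rw [dist_ne_zero_iff_ne_and_reachable]
              exact ⟨hxw, hux.symm.reachable.trans huw.reachable⟩
            have h1' : G.dist x w ≠ 1 := fun he =>
              h.triangle u w x hu hw huw hux (dist_eq_one_iff_adj.1 he).symm
            omega
          obtain ⟨y, hy, hy'⟩ := h1 w hw hd
          refine ⟨.inl y, hy, (isLeaf_attachPath_inl ?_).2 hy'⟩
          rintro rfl
          exact h.triangle u w _ hu hw huw hux hy
        · obtain ⟨y, hy, hy'⟩ := h.leaf_of_not_leaf u w x hu hw huw hux hxw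
            (by rwa [isLeaf_attachPath_inl hxv] at hx)
          obtain rfl | hyv := eq_or_ne y v
          · obtain ⟨z, hz, hz', hz''⟩ | h2 := h2 w u hy.symm huw.symm hw hu
            · exact ⟨.inl z, hz', (isLeaf_attachPath_inl hz).2 hz''⟩
            · rw [isLeaf_attachPath_inl hxv] at hx
              exact absurd (h2 x hux hxw) hx
          · exact ⟨.inl y, hy, (isLeaf_attachPath_inl hyv).2 hy'⟩
      · obtain ⟨rfl, -⟩ := hux
        simp [hvL] at hu
    · obtain ⟨rfl, -⟩ := huw; simp [hvL] at hu
    · obtain ⟨rfl, -⟩ := huw; simp [hvL] at hw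
    · fin_cases w <;> simp at hw
      · -- here `u` is the middle new vertex, whose only other neighbour is a leaf
        have hu1 : u = 1 := by
          fin_cases u <;> simp [pathGraph_adj] at huw ⊢
        subst hu1
        rcases x with x | x
        · simp at hux
        · fin_cases x
          · simp at hxw
          · simp at hux
          · exact absurd isLeaf_attachPath_inr_two hx
      · exact ⟨.inr 2, by simp [pathGraph_adj], isLeaf_attachPath_inr_two⟩

end attach
end IsDoubleStarLabelling

lemma LabelledFamily.isDoubleStarLabelling {V : Type u} {G : SimpleGraph V} {l : V → VLabel}
    (h : LabelledFamily G l) : IsDoubleStarLabelling G l := by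
  induction h with
  | base G l e hl => exact IsDoubleStarLabelling.pathGraph_four.iso e hl
  | op1 G l v _ hv ih => exact ih.attachPath hv
  | op2 G l v _ hv ih => exact ih.attachLeaf hv
  | iso G H l m _ e hl ih => exact ih.iso e hl

/-! ### Edge dominating sets -/

section
variable {V : Type u} {G : SimpleGraph V}

lemma mem_of_forall_adj (hG : G.Connected) {s : Set V} {a : V} (ha : a ∈ s)
    (hs : ∀ x ∈ s, ∀ y, G.Adj x y → y ∈ s) (x : V) : x ∈ s := by
  obtain ⟨p⟩ := hG.preconnected a x
  induction p with
  | nil => exact ha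
  | cons h _ ih => exact ih (hs _ ha _ h)

lemma eq_starGraph (hG : G.Connected) {a : V}
    (ha : ∀ x, G.Adj a x → ∀ y, G.Adj x y → y = a) : G = starGraph a := by
  have key : ∀ x, x = a ∨ G.Adj a x := by
    refine mem_of_forall_adj hG (s := {x | x = a ∨ G.Adj a x}) (.inl rfl) ?_
    rintro x (rfl | hx) y hy
    · exact .inr hy
    · exact .inl (ha x hx y hy)
  ext x y
  rw [starGraph_adj]
  constructor
  · intro h
    refine ⟨h.ne, ?_⟩
    rcases key x with rfl | hx
    · exact .inl rfl
    · exact .inr (ha x hx y h)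
  · rintro ⟨hne, rfl | rfl⟩
    · exact (key y).resolve_left hne.symm
    · exact ((key x).resolve_left hne).symm

/-- In a connected graph that is not a star, every edge is adjacent to another one. -/
lemma exists_lineGraph_adj (hG : G.Connected) (hstar : ¬ ∃ r : V, G = starGraph r)
    (e : G.edgeSet) : ∃ f, G.lineGraph.Adj e f := by
  obtain ⟨e, he⟩ := e
  induction e using Sym2.ind with
  | _ a b =>
  by_contra! hno
  rw [mem_edgeSet] at he
  simp only [lineGraph_adj_iff_exists, not_and, not_exists] at hno
  have ha : ∀ x, G.Adj a x → x = b := by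
    intro x hx
    by_contra hxb
    refine hno ⟨s(a, x), hx⟩ ?_ a (by simp) (by simp)
    intro heq
    have := congrArg Subtype.val heq
    grind
  have hb : ∀ x, G.Adj b x → x = a := by
    intro x hx
    by_contra hxb
    refine hno ⟨s(b, x), hx⟩ ?_ b (by simp) (by simp)
    intro heq
    have := congrArg Subtype.val heq
    grind
  exact hstar ⟨a, eq_starGraph hG fun x hx y hy => hb y (ha x hx ▸ hy)⟩

lemma edgeDominationNumber_le {F : Finset G.edgeSet} (hF : IsEdgeDominating G F) :
    edgeDominationNumber G ≤ F.card := Nat.sInf_le ⟨F, hF, rfl⟩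

lemma totalEdgeDominationNumber_le {F : Finset G.edgeSet} (hF : IsTotalEdgeDominating G F) :
    totalEdgeDominationNumber G ≤ F.card := Nat.sInf_le ⟨F, hF, rfl⟩

lemma exists_isEdgeDominating [Finite V] (G : SimpleGraph V) :
    ∃ F, IsEdgeDominating G F ∧ F.card = edgeDominationNumber G := by
  classical
  have := Fintype.ofFinite G.edgeSet
  exact Nat.sInf_mem (s := {n : ℕ | ∃ F : Finset G.edgeSet, IsEdgeDominating G F ∧ F.card = n})
    ⟨_, Finset.univ, fun e he => absurd (Finset.mem_univ e) he, rfl⟩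

lemma exists_isTotalEdgeDominating [Finite V]
    (hG : ∀ e : G.edgeSet, ∃ f, G.lineGraph.Adj e f) :
    ∃ F, IsTotalEdgeDominating G F ∧ F.card = totalEdgeDominationNumber G := by
  classical
  have := Fintype.ofFinite G.edgeSet
  refine Nat.sInf_mem
    (s := {n : ℕ | ∃ F : Finset G.edgeSet, IsTotalEdgeDominating G F ∧ F.card = n})
    ⟨_, Finset.univ, fun e => ?_, rfl⟩
  obtain ⟨f, hf⟩ := hG e
  exact ⟨f, Finset.mem_univ f, hf⟩

open Classical in
/-- Adding to an edge dominating set a neighbour of each of its members makes it total. -/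
lemma IsEdgeDominating.total_union {F N : Finset G.edgeSet} (hF : IsEdgeDominating G F)
    (hN : ∀ e ∈ F, ∃ f ∈ F ∪ N, G.lineGraph.Adj e f) : IsTotalEdgeDominating G (F ∪ N) := by
  intro e
  by_cases he : e ∈ F
  · exact hN e he
  · obtain ⟨f, hf, h⟩ := hF e he
    exact ⟨f, Finset.mem_union_left _ hf, h⟩

lemma totalEdgeDominationNumber_le_two_mul [Finite V]
    (hG : ∀ e : G.edgeSet, ∃ f, G.lineGraph.Adj e f) :
    totalEdgeDominationNumber G ≤ 2 * edgeDominationNumber G := by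
  classical
  obtain ⟨F, hF, hcard⟩ := exists_isEdgeDominating G
  choose g hg using hG
  have h := totalEdgeDominationNumber_le (hF.total_union (N := F.image g) fun e he =>
    ⟨g e, Finset.mem_union_right _ (Finset.mem_image_of_mem g he), hg e⟩)
  have h1 := Finset.card_union_le F (F.image g)
  have h2 := Finset.card_image_le (s := F) (f := g)
  omega

/-- If `γ'ₜ = 2γ'`, two members of a minimum edge dominating set are not adjacent: otherwise one of
them needs no extra edge to be totally dominated. -/
lemma IsEdgeDominating.not_adj_of_card_eq (hG : ∀ e : G.edgeSet, ∃ f, G.lineGraph.Adj e f)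
    {F : Finset G.edgeSet} (hF : IsEdgeDominating G F)
    (hcard : totalEdgeDominationNumber G = 2 * F.card) {f₁ f₂ : G.edgeSet} (h₁ : f₁ ∈ F)
    (h₂ : f₂ ∈ F) : ¬ G.lineGraph.Adj f₁ f₂ := by
  classical
  intro hadj
  choose g hg using hG
  have h := totalEdgeDominationNumber_le (hF.total_union (N := (F.erase f₁).image g) fun e he => by
    by_cases hef : e = f₁
    · exact ⟨f₂, Finset.mem_union_left _ h₂, hef ▸ hadj⟩
    · exact ⟨g e, Finset.mem_union_right _ (Finset.mem_image_of_mem g (by simp [hef, he])), hg e⟩)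
  have h3 := Finset.card_union_le F ((F.erase f₁).image g)
  have h4 := Finset.card_image_le (s := F.erase f₁) (f := g)
  have h5 := Finset.card_erase_add_one h₁
  omega

/-- If `γ'ₜ = 2γ'`, no edge is adjacent to two members of a minimum edge dominating set: otherwise
that edge serves both of them. -/
lemma IsEdgeDominating.eq_of_card_eq (hG : ∀ e : G.edgeSet, ∃ f, G.lineGraph.Adj e f)
    {F : Finset G.edgeSet} (hF : IsEdgeDominating G F)
    (hcard : totalEdgeDominationNumber G = 2 * F.card) {e f₁ f₂ : G.edgeSet} (h₁ : f₁ ∈ F)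
    (h₂ : f₂ ∈ F) (he₁ : G.lineGraph.Adj f₁ e) (he₂ : G.lineGraph.Adj f₂ e) : f₁ = f₂ := by
  classical
  by_contra hne
  choose g hg using hG
  have h := totalEdgeDominationNumber_le
    (hF.total_union (N := insert e (((F.erase f₁).erase f₂).image g)) fun e' he' => by
      by_cases h1 : e' = f₁
      · exact ⟨e, by simp, h1 ▸ he₁⟩
      by_cases h2 : e' = f₂
      · exact ⟨e, by simp, h2 ▸ he₂⟩
      · exact ⟨g e', Finset.mem_union_right _ (Finset.mem_insert_of_mem
          (Finset.mem_image_of_mem g (by simp [h1, h2, he']))), hg e'⟩)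
  have h3 := Finset.card_union_le F (insert e (((F.erase f₁).erase f₂).image g))
  have h4 := Finset.card_insert_le e (((F.erase f₁).erase f₂).image g)
  have h5 := Finset.card_image_le (s := (F.erase f₁).erase f₂) (f := g)
  have h6 := Finset.card_erase_add_one h₁
  have h7 := Finset.card_erase_add_one (s := F.erase f₁) (a := f₂)
    (by simp [Ne.symm hne, h₂])
  omega

/-- A leaf at `y` forces a member of a total edge dominating set at `y`, other than the edge to that
leaf. -/
lemma IsTotalEdgeDominating.exists_of_isLeaf {F : Finset G.edgeSet}
    (hF : IsTotalEdgeDominating G F) {y x : V} (hyx : G.Adj y x) (hx : IsLeaf G x) :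
    ∃ f ∈ F, y ∈ f.1 ∧ f.1 ≠ s(y, x) := by
  obtain ⟨f, hf, hadj⟩ := hF ⟨s(y, x), hyx⟩
  rw [lineGraph_adj_iff_exists] at hadj
  obtain ⟨hne, z, hz, hzf⟩ := hadj
  refine ⟨f, hf, ?_, fun he => hne (Subtype.ext he.symm)⟩
  rcases Sym2.mem_iff.1 hz with rfl | rfl
  · exact hzf
  · obtain ⟨f, hfE⟩ := f
    obtain ⟨t, rfl⟩ := hzf
    obtain rfl : t = y := hx.eq hfE hyx.symm
    simp

end

namespace IsDoubleStarLabelling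
variable {V : Type u} {G : SimpleGraph V} {l : V → VLabel}

/-! ### Counting edges in the double stars -/

/-- An edge sharing a vertex labelled `C` with an edge `uw` whose ends are labelled `C` determines
that edge `uw`. -/
lemma eq_of_mem (h : IsDoubleStarLabelling G l) {m m' e : G.edgeSet}
    (hm : ∀ x ∈ m.1, l x = .C) (hm' : ∀ x ∈ m'.1, l x = .C) {p p' : V}
    (hp : p ∈ m.1) (hp' : p' ∈ m'.1) (hpe : p ∈ e.1) (hpe' : p' ∈ e.1) : m = m' := by
  obtain ⟨⟨m, hmE⟩, ⟨m', hmE'⟩, e, heE⟩ := m, m', e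
  simp only at *
  obtain ⟨q, rfl⟩ := hp
  obtain ⟨q', rfl⟩ := hp'
  have hpC := hm p (by simp)
  have hqC := hm q (by simp)
  have hpC' := hm' p' (by simp)
  have hqC' := hm' q' (by simp)
  rw [mem_edgeSet] at hmE hmE'
  rw [Subtype.mk.injEq]
  obtain rfl | hne := eq_or_ne p p'
  · rw [h.partner_unique p q q' hpC hmE hqC hmE' hqC']
  · obtain rfl := (Sym2.mem_and_mem_iff hne).1 ⟨hpe, hpe'⟩
    rw [mem_edgeSet] at heE
    rw [h.partner_unique p q p' hpC hmE hqC heE hpC',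
      h.partner_unique p' q' p hpC' hmE' hqC' heE.symm hpC, Sym2.eq_swap]

/-- If `w` has no leaf, then `u` has only leaves besides `w`; a total edge dominating set then has
two edges at `u`, or the edge `uw` and one adjacent to it. -/
lemma exists_ne_of_not_exists_isLeaf (h : IsDoubleStarLabelling G l) {F D : Finset G.edgeSet}
    (hF : IsTotalEdgeDominating G F) {u w : V} (hu : l u = .C) (hw : l w = .C) (huw : G.Adj u w)
    (hwl : ¬ ∃ x, G.Adj w x ∧ IsLeaf G x) (hD : ∀ e ∈ F, u ∈ e.1 → e ∈ D) {f : G.edgeSet}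
    (hf : f ∈ D) (hfuw : f.1 ≠ s(u, w)) : ∃ e ∈ D, ∃ f ∈ D, e ≠ f := by
  have hleaf : ∀ x, G.Adj u x → x ≠ w → IsLeaf G x := by
    intro x hx hxw
    by_contra hx'
    exact hwl (h.leaf_of_not_leaf u w x hu hw huw hx hxw hx')
  obtain ⟨x, hx, hxL⟩ := h.exists_L u hu
  have hxw : x ≠ w := by rintro rfl; simp [hw] at hxL
  obtain ⟨f₁, hf₁, hu₁, -⟩ := hF.exists_of_isLeaf hx (hleaf x hx hxw)
  obtain ⟨f₁, hE₁⟩ := f₁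
  obtain ⟨y, rfl⟩ := hu₁
  obtain rfl | hyw := eq_or_ne y w
  · exact ⟨_, hf, _, hD _ hf₁ (by simp), fun he => hfuw (congrArg Subtype.val he)⟩
  · obtain ⟨f₂, hf₂, hu₂, hne⟩ := hF.exists_of_isLeaf hE₁ (hleaf y hE₁ hyw)
    exact ⟨f₂, hD _ hf₂ hu₂, _, hD _ hf₁ (by simp), fun he => hne (congrArg Subtype.val he)⟩

/-- A total edge dominating set has two edges in each double star. -/
lemma two_le_card_filter (h : IsDoubleStarLabelling G l) {F : Finset G.edgeSet}
    (hF : IsTotalEdgeDominating G F) {u w : V} (hu : l u = .C) (hw : l w = .C) (huw : G.Adj u w)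
    [DecidablePred fun e : G.edgeSet => u ∈ e.1 ∨ w ∈ e.1] :
    2 ≤ (F.filter fun e => u ∈ e.1 ∨ w ∈ e.1).card := by
  set D := F.filter fun e => u ∈ e.1 ∨ w ∈ e.1 with hD
  suffices ∃ e ∈ D, ∃ f ∈ D, e ≠ f by
    obtain ⟨e, he, f, hf, hne⟩ := this
    exact Finset.one_lt_card.2 ⟨e, he, f, hf, hne⟩
  have huD : ∀ e ∈ F, u ∈ e.1 → e ∈ D := fun e he hue => by simp [hD, he, hue]
  have hwD : ∀ e ∈ F, w ∈ e.1 → e ∈ D := fun e he hwe => by simp [hD, he, hwe]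
  obtain ⟨f, hf, hadj⟩ := hF ⟨s(u, w), huw⟩
  rw [lineGraph_adj_iff_exists] at hadj
  obtain ⟨hne, z, hz, hzf⟩ := hadj
  have hfuw : f.1 ≠ s(u, w) := fun he => hne (Subtype.ext he.symm)
  have hfD : f ∈ D := by
    rcases Sym2.mem_iff.1 hz with rfl | rfl
    · exact huD f hf hzf
    · exact hwD f hf hzf
  by_cases hwl : ∃ x, G.Adj w x ∧ IsLeaf G x
  · by_cases hul : ∃ x, G.Adj u x ∧ IsLeaf G x
    · obtain ⟨x, hx, hx'⟩ := hwl
      obtain ⟨y, hy, hy'⟩ := hul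
      obtain ⟨f₁, hf₁, hw₁, -⟩ := hF.exists_of_isLeaf hx hx'
      obtain ⟨f₂, hf₂, hu₂, -⟩ := hF.exists_of_isLeaf hy hy'
      obtain rfl | hne' := eq_or_ne f₁ f₂
      · refine ⟨f₁, hwD _ hf₁ hw₁, f, hfD, ?_⟩
        rintro rfl
        exact hfuw ((Sym2.mem_and_mem_iff huw.ne).1 ⟨hu₂, hw₁⟩)
      · exact ⟨f₁, hwD _ hf₁ hw₁, f₂, huD _ hf₂ hu₂, hne'⟩
    · exact h.exists_ne_of_not_exists_isLeaf hF hw hu huw.symm hul hwD hfD (Sym2.eq_swap ▸ hfuw)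
  · exact h.exists_ne_of_not_exists_isLeaf hF hu hw huw hwl huD hfD hfuw

/-- The edges with both ends labelled `C` dominate, and a total edge dominating set has two edges
in each of the pairwise edge-disjoint double stars around them. -/
lemma two_mul_le [Finite V] (h : IsDoubleStarLabelling G l)
    (hG : ∀ e : G.edgeSet, ∃ f, G.lineGraph.Adj e f) :
    2 * edgeDominationNumber G ≤ totalEdgeDominationNumber G := by
  classical
  have := Fintype.ofFinite G.edgeSet
  set M : Finset G.edgeSet := Finset.univ.filter fun e => ∀ x ∈ e.1, l x = .C with hM
  have hMdom : IsEdgeDominating G M := by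
    rintro ⟨e, he⟩ heM
    have hc : ∃ c ∈ e, l c = .C := by
      induction e using Sym2.ind with
      | _ a b =>
      by_cases ha : l a = .C
      · exact ⟨a, by simp, ha⟩
      · exact ⟨b, by simp, h.indep a b he (VLabel.eq_L_of_ne ha)⟩
    obtain ⟨c, hce, hc⟩ := hc
    obtain ⟨d, hd, hd'⟩ := h.exists_partner c hc
    have hcd : (⟨s(c, d), hd⟩ : G.edgeSet) ∈ M := by simp [hM, hc, hd']
    refine ⟨_, hcd, lineGraph_adj_iff_exists.2 ⟨fun heq => heM (heq ▸ hcd), c, hce, by simp⟩⟩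
  obtain ⟨F, hF, hcard⟩ := exists_isTotalEdgeDominating hG
  have hdisj : (M : Set G.edgeSet).PairwiseDisjoint
      fun m => F.filter fun e => ∃ p ∈ m.1, p ∈ e.1 := by
    intro m hm m' hm' hne
    refine Finset.disjoint_left.2 fun e he he' => hne ?_
    simp only [Finset.mem_filter] at he he'
    obtain ⟨-, p, hp, hpe⟩ := he
    obtain ⟨-, p', hp', hpe'⟩ := he'
    exact h.eq_of_mem (Finset.mem_filter.1 hm).2 (Finset.mem_filter.1 hm').2 hp hp' hpe hpe'
  have htwo : ∀ m ∈ M, 2 ≤ (F.filter fun e => ∃ p ∈ m.1, p ∈ e.1).card := by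
    rintro ⟨m, hmE⟩ hm
    have hm := (Finset.mem_filter.1 hm).2
    induction m using Sym2.ind with
    | _ u w => simpa using h.two_le_card_filter hF (hm u (by simp)) (hm w (by simp)) hmE
  calc 2 * edgeDominationNumber G ≤ 2 * M.card :=
        Nat.mul_le_mul_left 2 (edgeDominationNumber_le hMdom)
    _ = ∑ m ∈ M, 2 := by simp [mul_comm]
    _ ≤ ∑ m ∈ M, (F.filter fun e => ∃ p ∈ m.1, p ∈ e.1).card := Finset.sum_le_sum htwo
    _ = (M.biUnion fun m => F.filter fun e => ∃ p ∈ m.1, p ∈ e.1).card :=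
        (Finset.card_biUnion hdisj).symm
    _ ≤ F.card := Finset.card_le_card (Finset.biUnion_subset.2 fun m _ => Finset.filter_subset _ _)
    _ = totalEdgeDominationNumber G := hcard

end IsDoubleStarLabelling

/-! ### The labelling given by a minimum edge dominating set -/

section
variable {V : Type u} {G : SimpleGraph V}

lemma not_adj_of_isAcyclic (hac : G.IsAcyclic) {u w v : V} (huw : G.Adj u w) (huv : G.Adj u v) :
    ¬ G.Adj w v := by
  classical
  exact fun hwv => hac.cliqueFree le_rfl {u, w, v} (is3Clique_triple_iff.2 ⟨huw, huv, hwv⟩)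

/-- In a forest, a vertex on some path between `s` and `t` is on every walk between them. -/
lemma mem_support_of_isPath (hac : G.IsAcyclic) {s t w : V} {p : G.Walk s t} (hp : p.IsPath)
    (hw : w ∈ p.support) (q : G.Walk s t) : w ∈ q.support := by
  classical
  have h := (hac.subsingleton_path s t).elim ⟨p, hp⟩ ⟨q.bypass, q.bypass_isPath⟩
  have h' : p = q.bypass := congrArg Subtype.val h
  exact q.support_bypass_subset_support (h' ▸ hw)

/-- In a forest, an edge `pq` avoiding `w` is linked to at most one vertex among `v` and the other
neighbours of `w`, where `v` and `w` are neighbours of `u`: two such vertices are already joined by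
a path through `w`. -/
lemma eq_of_linked (hac : G.IsAcyclic) {u w v p q s t : V} (huw : G.Adj u w) (huv : G.Adj u v)
    (hvw : v ≠ w) (hpq : G.Adj p q) (hp : p ≠ w) (hq : q ≠ w)
    (hs : s = v ∨ G.Adj w s ∧ s ≠ u) (ht : t = v ∨ G.Adj w t ∧ t ≠ u)
    (hsp : G.Adj s p ∨ G.Adj s q) (htp : G.Adj t p ∨ G.Adj t q) : s = t := by
  by_contra hst
  have hsw : s ≠ w := by rcases hs with rfl | hs; exacts [hvw, hs.1.ne']
  have htw : t ≠ w := by rcases ht with rfl | ht; exacts [hvw, ht.1.ne']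
  have hP : ∃ P : G.Walk s t, P.IsPath ∧ w ∈ P.support := by
    rcases hs with rfl | ⟨hs, hsu⟩
    · rcases ht with rfl | ⟨ht, htu⟩
      · exact absurd rfl hst
      · exact ⟨.cons huv.symm (.cons huw (.cons ht .nil)), by
          simp [huw.ne, huv.ne', hvw, hst, htu.symm, htw.symm], by simp⟩
    · rcases ht with rfl | ⟨ht, htu⟩
      · exact ⟨.cons hs.symm (.cons huw.symm (.cons huv .nil)), by
          simp [huw.ne', huv.ne, hsw, hst, hsu, htw.symm], by simp⟩
      · exact ⟨.cons hs.symm (.cons ht .nil), by simp [hsw, hst, htw.symm], by simp⟩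
  obtain ⟨P, hP, hwP⟩ := hP
  have hQ : ∃ Q : G.Walk s t, w ∉ Q.support := by
    rcases hsp with hsp | hsp <;> rcases htp with htp | htp
    · exact ⟨.cons hsp (.cons htp.symm .nil), by simp [hsw.symm, hp.symm, htw.symm]⟩
    · exact ⟨.cons hsp (.cons hpq (.cons htp.symm .nil)), by
        simp [hsw.symm, hp.symm, hq.symm, htw.symm]⟩
    · exact ⟨.cons hsp (.cons hpq.symm (.cons htp.symm .nil)), by
        simp [hsw.symm, hp.symm, hq.symm, htw.symm]⟩
    · exact ⟨.cons hsp (.cons htp.symm .nil), by simp [hsw.symm, hq.symm, htw.symm]⟩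
  obtain ⟨Q, hQ⟩ := hQ
  exact hQ (mem_support_of_isPath hac hP hwP Q)

/-- If `w` has no leaf although its partner `u` has a neighbour `v` that is not a leaf, there is a
total edge dominating set of size less than twice the number of edges with both ends labelled `C`:
take all these edges except `uw`, add `uv`, and add for every other such edge one adjacent to it,
leading to `v` or to a neighbour of `w` whenever possible. -/
lemma exists_isLeaf_of_card_eq (hac : G.IsAcyclic)
    (hG : ∀ e : G.edgeSet, ∃ f, G.lineGraph.Adj e f) {l : V → VLabel} {F : Finset G.edgeSet}
    (hF : ∀ e : G.edgeSet, e ∈ F ↔ ∀ x ∈ e.1, l x = .C)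
    (hcard : totalEdgeDominationNumber G = 2 * F.card)
    (hpart : ∀ c, l c = .C → ∃ d, G.Adj c d ∧ l d = .C)
    (huniq : ∀ c d d', l c = .C → G.Adj c d → l d = .C → G.Adj c d' → l d' = .C → d = d')
    (hind : ∀ x y, G.Adj x y → l x = .L → l y = .C) {u w v : V} (hu : l u = .C) (hw : l w = .C)
    (huw : G.Adj u w) (huv : G.Adj u v) (hvw : v ≠ w) (hv : ¬ IsLeaf G v) :
    ∃ x, G.Adj w x ∧ IsLeaf G x := by
  classical
  by_contra! hno
  set S : Set V := {s | s = v ∨ G.Adj w s ∧ s ≠ u} with hS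
  have hSL : ∀ s ∈ S, l s = .L := by
    rintro s (rfl | ⟨hs, hsu⟩)
    · exact VLabel.eq_L_of_ne fun hC => hvw (huniq u s w hu huv hC huw hw)
    · exact VLabel.eq_L_of_ne fun hC => hsu (huniq w s u hw hs hC huw.symm hu)
  have hg : ∀ f : G.edgeSet, ∃ g : G.edgeSet, G.lineGraph.Adj f g ∧
      (f ∈ F → (∃ s ∈ S, ∃ p ∈ f.1, G.Adj s p) → ∃ s ∈ S, ∃ p ∈ f.1, g.1 = s(s, p)) := by
    intro f
    by_cases hf : f ∈ F ∧ ∃ s ∈ S, ∃ p ∈ f.1, G.Adj s p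
    · obtain ⟨hf, s, hs, p, hp, hsp⟩ := hf
      refine ⟨⟨s(s, p), hsp⟩, lineGraph_adj_iff_exists.2 ⟨?_, p, hp, by simp⟩,
        fun _ _ => ⟨s, hs, p, hp, rfl⟩⟩
      rintro rfl
      have := (hF _).1 hf s (by simp)
      simp [hSL s hs] at this
    · obtain ⟨g, hg⟩ := hG f
      exact ⟨g, hg, fun h1 h2 => absurd ⟨h1, h2⟩ hf⟩
  choose g hgadj hg using hg
  have hFuw : (⟨s(u, w), huw⟩ : G.edgeSet) ∈ F := by simp [hF, hu, hw]
  set F' := F.erase ⟨s(u, w), huw⟩ with hF'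
  set X := F' ∪ insert ⟨s(u, v), huv⟩ (F'.image g) with hX
  have hXcard : X.card < 2 * F.card := by
    have h1 := Finset.card_union_le F' (insert ⟨s(u, v), huv⟩ (F'.image g))
    have h2 := Finset.card_insert_le (⟨s(u, v), huv⟩ : G.edgeSet) (F'.image g)
    have h3 := Finset.card_image_le (s := F') (f := g)
    have h4 := Finset.card_erase_add_one hFuw
    rw [← hF'] at h4
    rw [← hX] at h1
    omega
  have huvX : (⟨s(u, v), huv⟩ : G.edgeSet) ∈ X := by simp [hX]
  -- a vertex labelled `C` other than `u` and `w` lies on an edge of `F'`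
  have hF'mem : ∀ c d (hcd : G.Adj c d), l c = .C → l d = .C → c ≠ u → c ≠ w →
      (⟨s(c, d), hcd⟩ : G.edgeSet) ∈ F' := by
    intro c d hcd hc hd hcu hcw
    refine Finset.mem_erase.2 ⟨fun heq => ?_, by simp [hF, hc, hd]⟩
    have heq : s(c, d) = s(u, w) := congrArg Subtype.val heq
    have : c ∈ s(u, w) := heq ▸ Sym2.mem_mk_left c d
    rcases Sym2.mem_iff.1 this with h | h
    exacts [hcu h, hcw h]
  have hlink : ∀ s ∈ S, ∀ c, G.Adj s c → c ≠ u → c ≠ w →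
      ∃ f ∈ X, ∃ p, p ≠ u ∧ p ≠ w ∧ f.1 = s(s, p) := by
    intro s hs c hsc hcu hcw
    have hc := hind s c hsc (hSL s hs)
    obtain ⟨d, hcd, hd⟩ := hpart c hc
    have hdu : d ≠ u := by
      rintro rfl; exact hcw (huniq d c w hu hcd.symm hc huw hw)
    have hdw : d ≠ w := by
      rintro rfl; exact hcu (huniq d c u hw hcd.symm hc huw.symm hu)
    have hmem := hF'mem c d hcd hc hd hcu hcw
    obtain ⟨t, ht, p, hp, hgt⟩ := hg _ (Finset.mem_of_mem_erase hmem) ⟨s, hs, c, by simp, hsc⟩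
    have htp : G.Adj t p := by
      have := (g ⟨s(c, d), hcd⟩).2
      rwa [hgt] at this
    have hp : p = c ∨ p = d := Sym2.mem_iff.1 hp
    obtain rfl : s = t := eq_of_linked hac huw huv hvw hcd hcw hdw hs ht (.inl hsc) (by
      rcases hp with rfl | rfl <;> simp [htp])
    refine ⟨_, ?_, p, ?_, ?_, hgt⟩
    · exact Finset.mem_union_right _ (Finset.mem_insert_of_mem (Finset.mem_image_of_mem g hmem))
    · rcases hp with rfl | rfl <;> assumption
    · rcases hp with rfl | rfl <;> assumption
  have hXdom : IsTotalEdgeDominating G X := by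
    intro e
    by_cases hc : ∃ c ∈ e.1, l c = .C ∧ c ≠ u ∧ c ≠ w
    · obtain ⟨c, hce, hc, hcu, hcw⟩ := hc
      obtain ⟨d, hcd, hd⟩ := hpart c hc
      have hmem := hF'mem c d hcd hc hd hcu hcw
      by_cases heq : e = ⟨s(c, d), hcd⟩
      · subst heq
        exact ⟨g _, Finset.mem_union_right _ (Finset.mem_insert_of_mem
          (Finset.mem_image_of_mem g hmem)), hgadj _⟩
      · exact ⟨_, Finset.mem_union_left _ hmem, lineGraph_adj_iff_exists.2 ⟨heq, c, hce, by simp⟩⟩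
    · have huwe : u ∈ e.1 ∨ w ∈ e.1 := by
        push Not at hc
        obtain ⟨e, he⟩ := e
        induction e using Sym2.ind with
        | _ a b =>
        have hab : l a = .C ∨ l b = .C := by
          by_cases ha : l a = .C
          · exact .inl ha
          · exact .inr (hind a b he (VLabel.eq_L_of_ne ha))
        simp only [Sym2.mem_iff, forall_eq_or_imp, forall_eq] at hc ⊢
        grind
      by_cases hue : u ∈ e.1
      · by_cases heq : e = ⟨s(u, v), huv⟩
        · subst heq
          obtain ⟨c, hvc, hcu⟩ := exists_adj_ne_of_not_isLeaf huv.symm hv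
          have hcw : c ≠ w := by rintro rfl; exact not_adj_of_isAcyclic hac huw huv hvc.symm
          obtain ⟨f, hf, p, hpu, hpw, hfp⟩ := hlink v (.inl rfl) c hvc hcu hcw
          refine ⟨f, hf, lineGraph_adj_iff_exists.2 ⟨?_, v, by simp, by simp [hfp]⟩⟩
          rintro rfl
          simp at hfp
          grind
        · exact ⟨_, huvX, lineGraph_adj_iff_exists.2 ⟨heq, u, hue, by simp⟩⟩
      · obtain ⟨e, he⟩ := e
        obtain ⟨x, rfl⟩ := huwe.resolve_left hue
        have hxu : x ≠ u := by rintro rfl; simp at hue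
        obtain ⟨c, hxc, hcw⟩ := exists_adj_ne_of_not_isLeaf
          (show G.Adj x w from G.adj_symm he) (hno x he)
        have hcu : c ≠ u := by rintro rfl; exact not_adj_of_isAcyclic hac huw.symm he hxc.symm
        obtain ⟨f, hf, p, hpu, hpw, hfp⟩ := hlink x (.inr ⟨he, hxu⟩) c hxc hcu hcw
        refine ⟨f, hf, lineGraph_adj_iff_exists.2 ⟨?_, x, by simp, by simp [hfp]⟩⟩
        rintro rfl
        simp at hfp
        grind
  have := totalEdgeDominationNumber_le hXdom
  omega

/-- If `γ'ₜ = 2γ'`, label the ends of the edges of a minimum edge dominating set `C`. -/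
lemma exists_isDoubleStarLabelling [Finite V] (hT : G.IsTree)
    (hstar : ¬ ∃ r : V, G = starGraph r)
    (hcard : totalEdgeDominationNumber G = 2 * edgeDominationNumber G) :
    ∃ l : V → VLabel, IsDoubleStarLabelling G l := by
  classical
  have hG := exists_lineGraph_adj hT.1 hstar
  obtain ⟨F, hF, hFc⟩ := exists_isEdgeDominating G
  rw [← hFc] at hcard
  let l : V → VLabel := fun x => if ∃ f ∈ F, x ∈ f.1 then .C else .L
  have hlC : ∀ x, l x = .C ↔ ∃ f ∈ F, x ∈ f.1 := by
    intro x
    simp only [l]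
    split_ifs with hx <;> simp only [hx]
  have hFl : ∀ e : G.edgeSet, e ∈ F ↔ ∀ x ∈ e.1, l x = .C := by
    intro e
    refine ⟨fun he x hx => (hlC x).2 ⟨e, he, hx⟩, fun h => ?_⟩
    by_contra heF
    obtain ⟨e, he⟩ := e
    induction e using Sym2.ind with
    | _ a b =>
    obtain ⟨f, hf, haf⟩ := (hlC a).1 (h a (by simp))
    obtain ⟨f', hf', hbf⟩ := (hlC b).1 (h b (by simp))
    obtain rfl : f = f' := hF.eq_of_card_eq hG hcard (e := ⟨s(a, b), he⟩) hf hf'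
      (lineGraph_adj_iff_exists.2 ⟨fun h => heF (h ▸ hf), a, haf, by simp⟩)
      (lineGraph_adj_iff_exists.2 ⟨fun h => heF (h ▸ hf'), b, hbf, by simp⟩)
    have : f = ⟨s(a, b), he⟩ := Subtype.ext ((Sym2.mem_and_mem_iff (G.ne_of_adj he)).1 ⟨haf, hbf⟩)
    exact heF (this ▸ hf)
  have hpart : ∀ c, l c = .C → ∃ d, G.Adj c d ∧ l d = .C := by
    intro c hc
    obtain ⟨⟨f, hfE⟩, hf, hcf⟩ := (hlC c).1 hc
    obtain ⟨d, rfl⟩ := hcf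
    exact ⟨d, hfE, (hlC d).2 ⟨_, hf, by simp⟩⟩
  have huniq : ∀ c d d', l c = .C → G.Adj c d → l d = .C → G.Adj c d' → l d' = .C → d = d' := by
    intro c d d' hc h1 hd h2 hd'
    by_contra hne
    refine hF.not_adj_of_card_eq hG hcard (f₁ := ⟨s(c, d), h1⟩) (f₂ := ⟨s(c, d'), h2⟩)
      (by simp [hFl, hc, hd]) (by simp [hFl, hc, hd'])
      (lineGraph_adj_iff_exists.2 ⟨fun heq => ?_, c, by simp, by simp⟩)
    have := congrArg Subtype.val heq
    grind
  have hind : ∀ x y, G.Adj x y → l x = .L → l y = .C := by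
    intro x y hxy hx
    have hnF : (⟨s(x, y), hxy⟩ : G.edgeSet) ∉ F := by simp [hFl, hx]
    obtain ⟨f, hf, hadj⟩ := hF _ hnF
    obtain ⟨-, z, hz, hzf⟩ := lineGraph_adj_iff_exists.1 hadj
    have hzC := (hlC z).2 ⟨f, hf, hzf⟩
    rcases Sym2.mem_iff.1 hz with rfl | rfl
    · simp [hx] at hzC
    · exact hzC
  refine ⟨l, hpart, huniq, ?_, hind, fun u w v _ _ => not_adj_of_isAcyclic hT.2,
    fun u w v hu hw huw huv hvw hv => exists_isLeaf_of_card_eq hT.2 hG hFl hcard hpart huniq hind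
      hu hw huw huv hvw hv⟩
  -- If `a` is a leaf with partner `b`, exchange the edge `ab` for `bx`, where `x` has a neighbour
  -- `y ≠ b`; the edge `xy` is then adjacent to two members of the new minimum set.
  intro a ha
  by_contra! hno
  obtain ⟨b, hab, hb⟩ := hpart a ha
  have haleaf : ∀ z, G.Adj a z → z = b := fun z hz =>
    huniq a z b ha hz (VLabel.eq_C_of_ne (hno z hz)) hab hb
  have hx : ∃ x, G.Adj b x ∧ ∃ y, G.Adj x y ∧ y ≠ b := by
    by_contra! h
    exact hstar ⟨b, eq_starGraph hT.1 h⟩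
  obtain ⟨x, hbx, y, hxy, hyb⟩ := hx
  have hxa : x ≠ a := by rintro rfl; exact hyb (haleaf y hxy)
  have hxL : l x = .L := VLabel.eq_L_of_ne fun hC => hxa (huniq b x a hb hbx hC hab.symm ha)
  have hya : y ≠ a := by rintro rfl; exact hbx.ne' (haleaf x hxy.symm)
  have habF : (⟨s(a, b), hab⟩ : G.edgeSet) ∈ F := by simp [hFl, ha, hb]
  have hbxF : (⟨s(b, x), hbx⟩ : G.edgeSet) ∉ F := by simp [hFl, hxL]
  have hF' : IsEdgeDominating G (insert ⟨s(b, x), hbx⟩ (F.erase ⟨s(a, b), hab⟩)) := by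
    intro e he
    have hebx : e ≠ ⟨s(b, x), hbx⟩ := fun h => he (by simp [h])
    suffices b ∈ e.1 ∨ ∃ f ∈ F.erase ⟨s(a, b), hab⟩, G.lineGraph.Adj e f by
      rcases this with hbe | ⟨f, hf, hadj⟩
      · exact ⟨_, Finset.mem_insert_self _ _, lineGraph_adj_iff_exists.2 ⟨hebx, b, hbe, by simp⟩⟩
      · exact ⟨f, Finset.mem_insert_of_mem hf, hadj⟩
    by_cases hbe : b ∈ e.1
    · exact .inl hbe
    right
    have heab : e ≠ ⟨s(a, b), hab⟩ := by rintro rfl; simp at hbe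
    have heF : e ∉ F := fun h => he (Finset.mem_insert_of_mem (Finset.mem_erase.2 ⟨heab, h⟩))
    obtain ⟨f, hf, hadj⟩ := hF e heF
    refine ⟨f, Finset.mem_erase.2 ⟨?_, hf⟩, hadj⟩
    rintro rfl
    obtain ⟨-, z, hze, hz⟩ := lineGraph_adj_iff_exists.1 hadj
    rcases Sym2.mem_iff.1 hz with rfl | rfl
    · obtain ⟨e, heE⟩ := e
      obtain ⟨t, rfl⟩ := hze
      obtain rfl := haleaf t heE
      simp at hbe
    · exact hbe hze
  have hcard' : totalEdgeDominationNumber G =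
      2 * (insert ⟨s(b, x), hbx⟩ (F.erase ⟨s(a, b), hab⟩)).card := by
    rw [hcard, Finset.card_insert_of_notMem (fun h => hbxF (Finset.mem_of_mem_erase h)),
      Finset.card_erase_add_one habF]
  obtain ⟨f, hf, hyf⟩ := (hlC y).1 (hind x y hxy hxL)
  have hxf : x ∉ f.1 := fun h => by simpa [hxL] using (hFl f).1 hf x h
  have hfab : f ≠ ⟨s(a, b), hab⟩ := by
    rintro rfl
    rcases Sym2.mem_iff.1 hyf with h | h
    exacts [hya h, hyb h]
  have heq := hF'.eq_of_card_eq hG hcard' (e := ⟨s(x, y), hxy⟩) (f₁ := ⟨s(b, x), hbx⟩) (f₂ := f)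
    (Finset.mem_insert_self _ _) (Finset.mem_insert_of_mem (Finset.mem_erase.2 ⟨hfab, hf⟩))
    (lineGraph_adj_iff_exists.2 ⟨fun h => by
      have := congrArg Subtype.val h
      simp at this; grind, x, by simp, by simp⟩)
    (lineGraph_adj_iff_exists.2 ⟨fun h => hxf (by simp [h]), y, hyf, by simp⟩)
  exact hxf (heq ▸ Sym2.mem_mk_right b x)

end

/-! ### A deepest double star -/

section
variable {V : Type u} {G : SimpleGraph V}

/-- In a tree rooted at `r`, a vertex has at most one neighbour closer to the root. -/
lemma eq_of_dist_eq (hT : G.IsTree) {r x y z : V} (hy : G.Adj y x) (hz : G.Adj z x)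
    (hdy : G.dist r x = G.dist r y + 1) (hdz : G.dist r x = G.dist r z + 1) : y = z := by
  obtain ⟨p, hp⟩ := hT.1.exists_walk_length_eq_dist r y
  obtain ⟨q, hq⟩ := hT.1.exists_walk_length_eq_dist r z
  have hp' : (p.concat hy).IsPath := (p.concat hy).isPath_of_length_eq_dist (by simp [hp, hdy])
  have hq' : (q.concat hz).IsPath := (q.concat hz).isPath_of_length_eq_dist (by simp [hq, hdz])
  have h := (hT.2.subsingleton_path r x).elim ⟨_, hp'⟩ ⟨_, hq'⟩
  exact (Walk.concat_inj (congrArg Subtype.val h)).1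

lemma exists_adj_dist_eq (hG : G.Connected) {r x : V} (hx : x ≠ r) :
    ∃ y, G.Adj y x ∧ G.dist r x = G.dist r y + 1 := by
  obtain ⟨p, hp⟩ := hG.exists_walk_length_eq_dist x r
  cases p with
  | nil => exact absurd rfl hx
  | @cons _ y _ h q =>
    refine ⟨y, h.symm, ?_⟩
    rw [Walk.length_cons, G.dist_comm] at hp
    have h1 := G.dist_le q
    have h2 := hG.dist_triangle (u := r) (v := y) (w := x)
    rw [dist_eq_one_iff_adj.2 h.symm] at h2
    rw [G.dist_comm] at h1
    omega

lemma connected_of_surjective {W : Type*} {H : SimpleGraph W} (hG : G.Connected) (f : V → W)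
    (hf : Function.Surjective f) (hadj : ∀ a b, G.Adj a b → H.Reachable (f a) (f b)) :
    H.Connected := by
  have := hG.nonempty
  have hW : Nonempty W := ‹Nonempty V›.map f
  refine ⟨fun x y => ?_⟩
  obtain ⟨x, rfl⟩ := hf x
  obtain ⟨y, rfl⟩ := hf y
  obtain ⟨p⟩ := hG.preconnected x y
  induction p with
  | nil => rfl
  | cons h _ ih => exact (hadj _ _ h).trans ih

lemma isLeaf_induce {s : Set V} {x : s} {y : V} (hx : IsLeaf G x) (hxy : G.Adj x y) (hy : y ∈ s) :
    IsLeaf (G.induce s) x :=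
  ⟨⟨y, hy⟩, hxy, fun _ hz => Subtype.ext (hx.eq hz hxy)⟩

end

namespace IsDoubleStarLabelling
variable {V : Type u} {G : SimpleGraph V} {l : V → VLabel}

/-- There is a pair `a`, `b` of adjacent vertices labelled `C` with only leaves around, apart from
one neighbour `v` of `a`: rooting the tree at a vertex labelled `L`, take `b` labelled `C` and as
deep as possible. -/
lemma exists_terminal [Finite V] (h : IsDoubleStarLabelling G l) (hT : G.IsTree)
    (hC : ∃ c, l c = .C) : ∃ a b v, l a = .C ∧ l b = .C ∧ G.Adj a b ∧ G.Adj a v ∧ v ≠ b ∧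
      (∀ x, G.Adj b x → x ≠ a → IsLeaf G x) ∧
      (∀ x, G.Adj a x → x ≠ b → x ≠ v → IsLeaf G x) := by
  obtain ⟨c, hc⟩ := hC
  obtain ⟨r, -, hr⟩ := h.exists_L c hc
  obtain ⟨b, hb, hmax⟩ := Set.exists_max_image {c | l c = .C} (G.dist r) (Set.toFinite _) ⟨c, hc⟩
  have hb : l b = .C := hb
  obtain ⟨a, hba, ha⟩ := h.exists_partner b hb
  have hdab : G.dist r b = G.dist r a + 1 := by
    have := hmax a ha
    have := hT.dist_eq_dist_add_one_of_adj r hba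
    omega
  have har : a ≠ r := by rintro rfl; simp [hr] at ha
  obtain ⟨v, hva, hdv⟩ := exists_adj_dist_eq hT.1 har
  -- below a neighbour `x` of a vertex as deep as `a` there is no room for a vertex labelled `C`
  have key : ∀ y x, G.Adj y x → G.dist r x = G.dist r y + 1 → G.dist r a ≤ G.dist r y →
      l x = .L → IsLeaf G x := by
    intro y x hyx hd hay hxL
    refine (isLeaf_iff_forall hyx.symm).2 fun z hz => ?_
    have hzC := h.indep x z hz hxL
    have h1 := hmax z hzC
    have h2 := hT.dist_eq_dist_add_one_of_adj r hz
    exact eq_of_dist_eq hT hz.symm hyx (by omega) hd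
  refine ⟨a, b, v, ha, hb, hba.symm, hva.symm, by rintro rfl; omega, ?_, ?_⟩
  · intro x hx hxa
    have hd : G.dist r x = G.dist r b + 1 := by
      refine (hT.dist_eq_dist_add_one_of_adj r hx).resolve_left fun h' => hxa ?_
      exact eq_of_dist_eq hT hx.symm hba.symm h' hdab
    exact key b x hx hd (by omega) (h.eq_L hb ha hba hx hxa)
  · intro x hx hxb hxv
    have hd : G.dist r x = G.dist r a + 1 := by
      refine (hT.dist_eq_dist_add_one_of_adj r hx).resolve_left fun h' => hxv ?_
      exact eq_of_dist_eq hT hx.symm hva h' hdv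
    exact key a x hx hd le_rfl (h.eq_L ha hb hba.symm hx hxb)

/-! ### Deleting a leaf -/

lemma isTree_induce_compl_singleton (hT : G.IsTree) {x c : V} (hx : IsLeaf G x)
    (hcx : G.Adj c x) : (G.induce {x}ᶜ).IsTree := by
  classical
  refine ⟨connected_of_surjective hT.1
    (fun z => if hz : z = x then ⟨c, hcx.ne⟩ else ⟨z, hz⟩) ?_ ?_, hT.2.induce _⟩
  · rintro ⟨z, hz⟩
    exact ⟨z, by simp [show z ≠ x from hz]⟩
  · intro a b hab
    by_cases ha : a = x
    · subst ha
      obtain rfl := hx.eq hab hcx.symm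
      simp [hab.ne']
    · by_cases hb : b = x
      · subst hb
        obtain rfl := hx.eq hab.symm hcx.symm
        simp [ha]
      · exact Adj.reachable (by simpa [ha, hb] using hab)

/-- A leaf `x` of `c` can be deleted if `c` has another leaf, or if `c` has another neighbour
labelled `L` and the partner of `c` has only leaves besides `c`. -/
lemma induce_compl_singleton (h : IsDoubleStarLabelling G l) {x y c : V} (hx : IsLeaf G x)
    (hc : l c = .C) (hcy : G.Adj c y) (hyL : l y = .L) (hyx : y ≠ x)
    (hor : IsLeaf G y ∨
      ∀ w, l w = .C → G.Adj c w → ∀ z, G.Adj w z → z ≠ c → IsLeaf G z) (hcx : G.Adj c x) :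
    IsDoubleStarLabelling (G.induce {x}ᶜ) (fun z => l z) where
  exists_partner := by
    rintro ⟨d, hd⟩ hdC
    obtain ⟨e, hde, he⟩ := h.exists_partner d hdC
    exact ⟨⟨e, fun hex => h.not_isLeaf he (hex ▸ hx)⟩, hde, he⟩
  partner_unique d e e' h1 h2 h3 h4 h5 := Subtype.ext (h.partner_unique d e e' h1 h2 h3 h4 h5)
  exists_L := by
    rintro ⟨d, hd⟩ hdC
    obtain rfl | hne := eq_or_ne d c
    · exact ⟨⟨y, hyx⟩, hcy, hyL⟩
    · obtain ⟨e, hde, he⟩ := h.exists_L d hdC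
      exact ⟨⟨e, by rintro rfl; exact hne (hx.eq hde.symm hcx.symm)⟩, hde, he⟩
  indep d e := h.indep d e
  triangle d e f := h.triangle d e f
  leaf_of_not_leaf := by
    rintro ⟨u, hu⟩ ⟨w, hw⟩ ⟨v, hv⟩ huC hwC huw huv hvw hvl
    simp only [comap_adj, Function.Embedding.subtype_apply, ne_eq, Subtype.mk.injEq] at *
    have hvl' : ¬ IsLeaf G v := fun hl => hvl (isLeaf_induce (x := ⟨v, hv⟩) hl huv.symm hu)
    obtain ⟨z, hz, hzl⟩ := h.leaf_of_not_leaf u w v huC hwC huw huv hvw hvl'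
    obtain rfl | hzx := eq_or_ne z x
    · obtain rfl : w = c := hx.eq hz.symm hcx.symm
      rcases hor with hyl | hor
      · exact ⟨⟨y, hyx⟩, hcy, isLeaf_induce (x := ⟨y, hyx⟩) hyl hcy.symm hw⟩
      · exact absurd (hor u huC huw.symm v huv hvw) hvl'
    · exact ⟨⟨z, hzx⟩, hz, isLeaf_induce (x := ⟨z, hzx⟩) hzl hz.symm hw⟩

lemma labelledFamily_of_induce_compl_singleton {x c : V} (hx : IsLeaf G x) (hc : l c = .C)
    (hxL : l x = .L) (hcx : G.Adj c x)
    (h : LabelledFamily (G.induce {x}ᶜ) (fun z => l z)) : LabelledFamily G l := by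
  have hbij : Function.Bijective (fun o : Option ({x}ᶜ : Set V) => o.elim x Subtype.val) := by
    constructor
    · rintro (_ | ⟨a, ha⟩) (_ | ⟨b, hb⟩) hab
      · rfl
      · exact absurd hab.symm hb
      · exact absurd hab ha
      · exact congrArg some (Subtype.ext hab)
    · intro z
      by_cases hz : z = x
      · exact ⟨none, hz.symm⟩
      · exact ⟨some ⟨z, hz⟩, rfl⟩
  have hiff : ∀ z, G.Adj z x ↔ z = c :=
    fun z => ⟨fun hz => hx.eq hz.symm hcx.symm, fun hz => hz ▸ hcx⟩
  have hsub : ∀ z (hz : z ∈ ({x}ᶜ : Set V)),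
      z = c ↔ (⟨z, hz⟩ : ({x}ᶜ : Set V)) = ⟨c, hcx.ne⟩ := fun _ _ => Subtype.mk_eq_mk.symm
  let e : EdgeDom.attachLeaf (G.induce {x}ᶜ) ⟨c, hcx.ne⟩ ≃g G :=
    { toEquiv := Equiv.ofBijective _ hbij
      map_rel_iff' := by
        rintro (_ | ⟨a, ha⟩) (_ | ⟨b, hb⟩)
        · simp
        · exact (G.adj_comm x b).trans ((hiff b).trans (hsub b hb))
        · exact (hiff a).trans (hsub a ha)
        · simp }
  refine .iso _ _ _ _ (.op2 _ _ ⟨c, hcx.ne⟩ h hc) e ?_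
  rintro (_ | z)
  · exact hxL
  · rfl

end IsDoubleStarLabelling

/-! ### Deleting a path -/

section
variable {V : Type u} {G : SimpleGraph V}

/-- A path `v`, `a`, `b`, `c` in `G` that hangs at `v`: neither `a` nor `b` has a neighbour off the
path, and `c` is a leaf. -/
structure IsPendantPath (G : SimpleGraph V) (v a b c : V) : Prop where
  adj_va : G.Adj v a
  adj_ab : G.Adj a b
  adj_bc : G.Adj b c
  v_ne_b : v ≠ b
  a_ne_c : a ≠ c
  v_ne_c : v ≠ c
  adj_a : ∀ x, G.Adj a x → x = v ∨ x = b
  adj_b : ∀ x, G.Adj b x → x = a ∨ x = c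
  adj_c : ∀ x, G.Adj c x → x = b

lemma IsPendantPath.isTree_induce {v a b c : V} (hT : G.IsTree) (hp : IsPendantPath G v a b c) :
    (G.induce ({a, b, c}ᶜ : Set V)).IsTree := by
  classical
  have hv : v ∈ ({a, b, c}ᶜ : Set V) := by simp [hp.adj_va.ne, hp.v_ne_b, hp.v_ne_c]
  refine ⟨connected_of_surjective hT.1
    (fun z => if hz : z ∈ ({a, b, c}ᶜ : Set V) then ⟨z, hz⟩ else ⟨v, hv⟩) ?_ ?_, hT.2.induce _⟩
  · rintro ⟨z, hz⟩
    exact ⟨z, by simp only [dif_pos hz]⟩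
  · have hside : ∀ y z, G.Adj y z → y ∈ ({a, b, c}ᶜ : Set V) → z ∉ ({a, b, c}ᶜ : Set V) →
        y = v := by
      intro y z hyz hy hz
      rw [Set.notMem_compl_iff] at hz
      simp only [Set.mem_compl_iff, Set.mem_insert_iff, Set.mem_singleton_iff, not_or] at hy hz
      rcases hz with rfl | rfl | rfl
      · exact (hp.adj_a y hyz.symm).resolve_right hy.2.1
      · exact ((hp.adj_b y hyz.symm).elim (fun h => absurd h hy.1) fun h => absurd h hy.2.2)
      · exact absurd (hp.adj_c y hyz.symm) hy.2.1
    intro y z hyz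
    by_cases hy : y ∈ ({a, b, c}ᶜ : Set V) <;> by_cases hz : z ∈ ({a, b, c}ᶜ : Set V)
    · simp only [dif_pos hy, dif_pos hz]
      exact Adj.reachable hyz
    · obtain rfl := hside y z hyz hy hz
      simp only [dif_pos hy, dif_neg hz, Reachable.rfl]
    · obtain rfl := hside z y hyz.symm hz hy
      simp only [dif_neg hy, dif_pos hz, Reachable.rfl]
    · simp only [dif_neg hy, dif_neg hz, Reachable.rfl]

end

namespace IsDoubleStarLabelling
variable {V : Type u} {G : SimpleGraph V} {l : V → VLabel} {v a b c : V}

/-- A leaf other than `c` at a vertex off the path is off the path. -/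
lemma notMem_of_isLeaf (h : IsDoubleStarLabelling G l) (hp : IsPendantPath G v a b c)
    (ha : l a = .C) (hb : l b = .C) {w x : V}
    (hw : w ∈ ({a, b, c}ᶜ : Set V))
    (hwx : G.Adj w x) (hx : IsLeaf G x) : x ∈ ({a, b, c}ᶜ : Set V) := by
  rintro (rfl | rfl | rfl)
  · exact h.not_isLeaf ha hx
  · exact h.not_isLeaf hb hx
  · have := hp.adj_c w hwx.symm
    simp [this] at hw

lemma induce_of_isPendantPath (h : IsDoubleStarLabelling G l) (hp : IsPendantPath G v a b c)
    (ha : l a = .C) (hb : l b = .C) :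
    IsDoubleStarLabelling (G.induce ({a, b, c}ᶜ : Set V)) (fun z => l z) where
  exists_partner := by
    rintro ⟨d, hd⟩ hdC
    obtain ⟨e, hde, he⟩ := h.exists_partner d hdC
    refine ⟨⟨e, ?_⟩, hde, he⟩
    simp only [Set.mem_compl_iff, Set.mem_insert_iff, Set.mem_singleton_iff, not_or] at hd
    rintro (rfl | rfl | rfl)
    · exact hd.2.1 (h.partner_unique _ d b ha hde.symm hdC hp.adj_ab hb)
    · exact hd.1 (h.partner_unique _ d a hb hde.symm hdC hp.adj_ab.symm ha)
    · exact hd.2.1 (hp.adj_c d hde.symm)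
  partner_unique d e e' h1 h2 h3 h4 h5 := Subtype.ext (h.partner_unique d e e' h1 h2 h3 h4 h5)
  exists_L := by
    rintro ⟨d, hd⟩ hdC
    obtain ⟨e, hde, he⟩ := h.exists_L d hdC
    refine ⟨⟨e, ?_⟩, hde, he⟩
    rintro (rfl | rfl | rfl)
    · simp [ha] at he
    · simp [hb] at he
    · have := hp.adj_c d hde.symm
      simp [this] at hd
  indep d e := h.indep d e
  triangle d e f := h.triangle d e f
  leaf_of_not_leaf := by
    rintro ⟨u, hu⟩ ⟨w, hw⟩ ⟨y, hy⟩ huC hwC huw huy hyw hyl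
    have hyl' : ¬ IsLeaf G y := fun hl => hyl (isLeaf_induce (x := ⟨y, hy⟩) hl huy.symm hu)
    obtain ⟨z, hz, hzl⟩ := h.leaf_of_not_leaf u w y huC hwC huw huy
      (fun he => hyw (Subtype.ext he)) hyl'
    have hzS := h.notMem_of_isLeaf hp ha hb hw hz hzl
    exact ⟨⟨z, hzS⟩, hz, isLeaf_induce (x := ⟨z, hzS⟩) hzl hz.symm hw⟩

lemma canAttach_of_isPendantPath (h : IsDoubleStarLabelling G l) (hp : IsPendantPath G v a b c)
    (ha : l a = .C) (hb : l b = .C)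
    (hvl : ¬ IsLeaf G v) (hvS : v ∈ ({a, b, c}ᶜ : Set V)) :
    CanAttach (G.induce ({a, b, c}ᶜ : Set V)) (fun z => l z) ⟨v, hvS⟩ := by
  have hvL : l v = .L := h.eq_L ha hb hp.adj_ab hp.adj_va.symm hp.v_ne_b
  refine ⟨hvL, ?_, ?_⟩
  · rintro ⟨w, hw⟩ hwC hd
    have hr : (G.induce ({a, b, c}ᶜ : Set V)).Reachable ⟨v, hvS⟩ ⟨w, hw⟩ :=
      Reachable.of_dist_ne_zero (by omega)
    obtain ⟨p, hp2⟩ := hr.exists_walk_length_eq_dist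
    rw [hd] at hp2
    obtain ⟨⟨u, hu⟩, hvu, huw⟩ : ∃ u, (G.induce ({a, b, c}ᶜ : Set V)).Adj ⟨v, hvS⟩ u ∧
        (G.induce ({a, b, c}ᶜ : Set V)).Adj u ⟨w, hw⟩ := by
      rcases p with _ | ⟨h1, _ | ⟨h2, _ | _⟩⟩
      · simp at hp2
      · simp at hp2
      · exact ⟨_, h1, h2⟩
      · simp at hp2
    have huC := h.indep v u hvu hvL
    have hvw : v ≠ w := by rintro rfl; simp at hd
    obtain ⟨x, hx, hxl⟩ := h.leaf_of_not_leaf u w v huC hwC huw hvu.symm hvw hvl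
    have hxS := h.notMem_of_isLeaf hp ha hb hw hx hxl
    exact ⟨⟨x, hxS⟩, hx, isLeaf_induce (x := ⟨x, hxS⟩) hxl hx.symm hw⟩
  · rintro ⟨u, hu⟩ ⟨w, hw⟩ hvu huw huC hwC
    rw [or_iff_not_imp_right]
    intro hno
    push Not at hno
    obtain ⟨⟨z, hz⟩, hwz, hzu, hzl⟩ := hno
    have hzl' : ¬ IsLeaf G z := fun hl => hzl (isLeaf_induce (x := ⟨z, hz⟩) hl hwz.symm hw)
    obtain ⟨x, hx, hxl⟩ := h.leaf_of_not_leaf w u z hwC huC huw.symm hwz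
      (fun he => hzu (Subtype.ext he)) hzl'
    have hxS := h.notMem_of_isLeaf hp ha hb hu hx hxl
    refine ⟨⟨x, hxS⟩, fun he => hvl ?_, hx, isLeaf_induce (x := ⟨x, hxS⟩) hxl hx.symm hu⟩
    obtain rfl : x = v := congrArg Subtype.val he
    exact hxl

lemma labelledFamily_of_isPendantPath (hp : IsPendantPath G v a b c)
    (ha : l a = .C) (hb : l b = .C) (hc : l c = .L) (hvS : v ∈ ({a, b, c}ᶜ : Set V))
    (h : LabelledFamily (G.induce ({a, b, c}ᶜ : Set V)) (fun z => l z))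
    (hv : CanAttach (G.induce ({a, b, c}ᶜ : Set V)) (fun z => l z) ⟨v, hvS⟩) :
    LabelledFamily G l := by
  have hmem : ∀ z, z ∈ ({a, b, c}ᶜ : Set V) ↔ z ≠ a ∧ z ≠ b ∧ z ≠ c := by simp
  have hab := hp.adj_ab.ne
  have hbc := hp.adj_bc.ne
  have hac := hp.a_ne_c
  have hbij : Function.Bijective
      (Sum.elim Subtype.val ![a, b, c] : ({a, b, c}ᶜ : Set V) ⊕ Fin 3 → V) := by
    constructor
    · refine Subtype.val_injective.sumElim ?_ ?_
      · intro i j hij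
        fin_cases i <;> fin_cases j <;> simp_all [eq_comm]
      · rintro ⟨z, hz⟩ i
        have := (hmem z).1 hz
        fin_cases i <;> simp_all
    · intro z
      by_cases hz : z ∈ ({a, b, c}ᶜ : Set V)
      · exact ⟨.inl ⟨z, hz⟩, rfl⟩
      · simp only [Set.mem_compl_iff, Set.mem_insert_iff, Set.mem_singleton_iff, not_not] at hz
        rcases hz with rfl | rfl | rfl
        exacts [⟨.inr 0, rfl⟩, ⟨.inr 1, rfl⟩, ⟨.inr 2, rfl⟩]
  have hside : ∀ z ∈ ({a, b, c}ᶜ : Set V), ∀ i : Fin 3, G.Adj z (![a, b, c] i) ↔ z = v ∧ i = 0 := by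
    intro z hz i
    have hz := (hmem z).1 hz
    fin_cases i
    · simp only [Fin.zero_eta, Matrix.cons_val_zero, and_true]
      exact ⟨fun h => (hp.adj_a z h.symm).resolve_right hz.2.1, fun h => h ▸ hp.adj_va⟩
    · simp only [Fin.mk_one, Matrix.cons_val_one, Matrix.cons_val_zero, one_ne_zero, and_false,
        iff_false]
      exact fun h => (hp.adj_b z h.symm).elim hz.1 hz.2.2
    · simp only [Fin.reduceFinMk, Matrix.cons_val, Fin.reduceEq, and_false, iff_false]
      exact fun h => hz.2.1 (hp.adj_c z h.symm)
  have hnac : ¬ G.Adj a c := fun h => hab (hp.adj_c a h.symm)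
  have hsub : ∀ z (hz : z ∈ ({a, b, c}ᶜ : Set V)),
      z = v ↔ (⟨z, hz⟩ : ({a, b, c}ᶜ : Set V)) = ⟨v, hvS⟩ := fun _ _ => Subtype.mk_eq_mk.symm
  let e : EdgeDom.attachPath (G.induce ({a, b, c}ᶜ : Set V)) ⟨v, hvS⟩ ≃g G :=
    { toEquiv := Equiv.ofBijective _ hbij
      map_rel_iff' := by
        rintro (⟨y, hy⟩ | i) (⟨z, hz⟩ | j)
        · simp
        · exact (hside y hy j).trans (and_congr_left' (hsub y hy))
        · exact (G.adj_comm _ z).trans ((hside z hz i).trans (and_congr_left' (hsub z hz)))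
        · have h1 := hp.adj_ab
          have h2 := hp.adj_bc
          have h3 := h1.symm
          have h4 := h2.symm
          have hnca : ¬ G.Adj c a := fun h => hnac h.symm
          fin_cases i <;> fin_cases j <;> simp [pathGraph_adj, h1, h2, h3, h4, hnac, hnca] }
  refine .iso _ _ _ _ (.op1 _ _ ⟨v, hvS⟩ h hv) e ?_
  rintro (z | i)
  · rfl
  · fin_cases i
    exacts [ha, hb, hc]

lemma labelledFamily_of_isLeaf (hG : G.Connected) (hp : IsPendantPath G v a b c)
    (hvl : IsLeaf G v) (hv : l v = .L) (ha : l a = .C) (hb : l b = .C) (hc : l c = .L) :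
    LabelledFamily G l := by
  have hbij : Function.Bijective ![v, a, b, c] := by
    constructor
    · have h1 := hp.adj_va.ne
      have h2 := hp.adj_ab.ne
      have h3 := hp.adj_bc.ne
      have h4 := hp.v_ne_b
      have h5 := hp.v_ne_c
      have h6 := hp.a_ne_c
      intro i j hij
      fin_cases i <;> fin_cases j <;> simp_all [eq_comm]
    · refine mem_of_forall_adj hG (s := Set.range ![v, a, b, c]) ⟨0, rfl⟩ ?_
      rintro _ ⟨i, rfl⟩ y hy
      fin_cases i
      · obtain rfl := hvl.eq hy hp.adj_va; exact ⟨1, rfl⟩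
      · rcases hp.adj_a y hy with rfl | rfl; exacts [⟨0, rfl⟩, ⟨2, rfl⟩]
      · rcases hp.adj_b y hy with rfl | rfl; exacts [⟨1, rfl⟩, ⟨3, rfl⟩]
      · obtain rfl := hp.adj_c y hy; exact ⟨2, rfl⟩
  let e : pathGraph 4 ≃g G :=
    { toEquiv := Equiv.ofBijective _ hbij
      map_rel_iff' := by
        have h1 := hp.adj_va
        have h2 := hp.adj_ab
        have h3 := hp.adj_bc
        have h1' := h1.symm
        have h2' := h2.symm
        have h3' := h3.symm
        have n1 : ¬ G.Adj v b := fun h => h2.ne (hvl.eq h1 h)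
        have n2 : ¬ G.Adj v c := fun h => hp.a_ne_c (hvl.eq h1 h)
        have n3 : ¬ G.Adj a c := fun h => h2.ne (hp.adj_c a h.symm)
        have n1' : ¬ G.Adj b v := fun h => n1 h.symm
        have n2' : ¬ G.Adj c v := fun h => n2 h.symm
        have n3' : ¬ G.Adj c a := fun h => n3 h.symm
        intro i j
        rw [pathGraph_adj]
        fin_cases i <;> fin_cases j <;> simp [*] }
  refine .base _ _ e fun i => ?_
  fin_cases i
  exacts [hv, ha, hb, hc]

/-- Every labelled tree of this kind is generated by the two operations: delete spare leaves of a
terminal double star, then the path that remains of it. -/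
theorem labelledFamily [Finite V] (h : IsDoubleStarLabelling G l) (hT : G.IsTree)
    (hC : ∃ c, l c = .C) : LabelledFamily G l := by
  induction hn : Nat.card V using Nat.strong_induction_on generalizing V with
  | _ n ih =>
  have hcard : ∀ (s : Set V) (x : V), x ∉ s → Nat.card s < n := by
    intro s x hx
    rw [← hn, Nat.card_coe_set_eq, ← Set.ncard_univ]
    exact Set.ncard_lt_ncard (Set.ssubset_univ_iff.2 fun hs => hx (hs ▸ Set.mem_univ x))
  obtain ⟨a, b, v, ha, hb, hab, hav, hvb, hbl, hal⟩ := h.exists_terminal hT hC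
  have hvL : l v = .L := h.eq_L ha hb hab hav hvb
  -- the deletion of a spare leaf
  have del : ∀ x y c, IsLeaf G x → l c = .C → G.Adj c x → G.Adj c y → l y = .L → y ≠ x →
      (IsLeaf G y ∨ ∀ w, l w = .C → G.Adj c w → ∀ z, G.Adj w z → z ≠ c → IsLeaf G z) →
      LabelledFamily G l := by
    intro x y c hx hc hcx hcy hyL hyx hor
    exact labelledFamily_of_induce_compl_singleton hx hc (h.eq_L_of_isLeaf hx) hcx
      (ih _ (hcard {x}ᶜ x (by simp)) (h.induce_compl_singleton hx hc hcy hyL hyx hor hcx)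
        (isTree_induce_compl_singleton hT hx hcx) ⟨⟨c, hcx.ne⟩, hc⟩ rfl)
  by_cases hx : ∃ x, G.Adj a x ∧ x ≠ b ∧ x ≠ v
  · obtain ⟨x, hax, hxb, hxv⟩ := hx
    refine del x v a (hal x hax hxb hxv) ha hax hav hvL hxv.symm (.inr fun w hw haw => ?_)
    obtain rfl := h.partner_unique a w b ha haw hw hab hb
    exact hbl
  obtain ⟨c, hbc, hcL⟩ := h.exists_L b hb
  have hca : c ≠ a := by rintro rfl; simp [ha] at hcL
  have hcl := hbl c hbc hca
  by_cases hy : ∃ x, G.Adj b x ∧ x ≠ a ∧ x ≠ c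
  · obtain ⟨x, hbx, hxa, hxc⟩ := hy
    exact del x c b (hbl x hbx hxa) hb hbx hbc hcL hxc.symm (.inl hcl)
  push Not at hx hy
  have hp : IsPendantPath G v a b c :=
    { adj_va := hav.symm
      adj_ab := hab
      adj_bc := hbc
      v_ne_b := hvb
      a_ne_c := hca.symm
      v_ne_c := by rintro rfl; exact hab.ne (hcl.eq hav.symm hbc.symm)
      adj_a := fun x hax => (em (x = b)).elim .inr fun hxb => .inl (hx x hax hxb)
      adj_b := fun x hbx => (em (x = a)).elim .inl fun hxa => .inr (hy x hbx hxa)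
      adj_c := fun x hcx => hcl.eq hcx hbc.symm }
  by_cases hvl : IsLeaf G v
  · exact labelledFamily_of_isLeaf hT.1 hp hvl hvL ha hb hcL
  have hvS : v ∈ ({a, b, c}ᶜ : Set V) := by simp [hav.ne', hvb, hp.v_ne_c]
  obtain ⟨u, hvu, hua⟩ := exists_adj_ne_of_not_isLeaf hav.symm hvl
  have huC := h.indep v u hvu hvL
  have huS : u ∈ ({a, b, c}ᶜ : Set V) := by
    rintro (rfl | rfl | rfl)
    · exact hua rfl
    · exact (hp.adj_b v hvu.symm).elim hav.ne' hp.v_ne_c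
    · simp [hcL] at huC
  exact labelledFamily_of_isPendantPath hp ha hb hcL hvS
    (ih _ (hcard _ a (by simp)) (h.induce_of_isPendantPath hp ha hb)
      (hp.isTree_induce hT) ⟨⟨u, huS⟩, huC⟩ rfl)
    (h.canAttach_of_isPendantPath hp ha hb hvl hvS)

end IsDoubleStarLabelling
end EdgeDom

theorem mainTheorem1 {V : Type u} [Finite V] (T : SimpleGraph V) (hT : T.IsTree)
    (hstar : ¬ ∃ r : V, T = SimpleGraph.starGraph r) :
    EdgeDom.totalEdgeDominationNumber T = 2 * EdgeDom.edgeDominationNumber T ↔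
      EdgeDom.InFamily T := by
  have hG := EdgeDom.exists_lineGraph_adj hT.1 hstar
  constructor
  · intro h
    obtain ⟨l, hl⟩ := EdgeDom.exists_isDoubleStarLabelling hT hstar h
    refine ⟨l, hl.labelledFamily hT ?_⟩
    by_contra! hno
    -- without a vertex labelled `C` there is no edge, so `T` is a one-vertex star
    obtain ⟨r⟩ := hT.1.nonempty
    refine hstar ⟨r, EdgeDom.eq_starGraph hT.1 fun x hx => ?_⟩
    exact absurd (hl.indep r x hx (EdgeDom.VLabel.eq_L_of_ne (hno r))) (hno x)
  · rintro ⟨l, hl⟩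
    exact le_antisymm (EdgeDom.totalEdgeDominationNumber_le_two_mul hG)
      (hl.isDoubleStarLabelling.two_mul_le hG)
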